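/- **Theorem.** Let $n>2$ and let $G=A\rtimes\mathbb S_n$ be a classical Weyl group, where $C_2=\{1,g_2\}$, $\mathbb S_n$ permutes the coordinates of $(C_2)^n$, and $A\subseteq (C_2)^n$ is trivial (giving $W(A_{n-1})$), all of $(C_2)^n$ (giving $W(B_n)\cong W(C_n)$), or the subgroup of tuples with an even number of entries $g_2$ (giving $W(D_n)$). Let $(G,r,\vec\rho,u)$ be a ramification system with irreducible representations over $\mathbb C$: a ramification $r=\sum_C r_C C$ with $r_C\in\mathbb N$, $C$ running over the conjugacy classes of $G$; a choice of $u(C)\in C$ for each class $C$; and for each $C$ with $r_C\neq 0$ a family $(\rho_C^{(i)})_{i\in I_C}$ of irreducible representations of the centralizer $G^{u(C)}$ with $\sum_i\deg\rho_C^{(i)}=r_C$. Assume $r\ne 0$. Let $M=\bigoplus_{C,i}M(\mathcal O_{u(C)},\rho_C^{(i)})$ be the associated Yetter–Drinfeld module over $\mathbb C G$, where $M(\mathcal O_{u(C)},\rho_C^{(i)})=\bigoplus_{t\in C}h_t\otimes X_C^{(i)}$ with $h_tu(C)h_t^{-1}=t$, and let $\mathfrak B(G,r,\vec\rho,u)$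 be the Nichols algebra of $M$. It is called a *central quantum linear space* if it is finite dimensional and * the braiding of $M$ is quantum symmetric: $c(x_a\otimes x_b)=q_{ab}\,x_b\otimes x_a$ for some basis $(x_a)$ of $M$, with $q_{ab}q_{ba}=1$ for $a\ne b$; * it is of non-essentially infinite type: each scalar operator $\rho_C^{(i)}(u(C))$ has finite order greater than $1$; * $C\subseteq Z(G)$ for all $C$ with $r_C\ne0$. Then $\mathfrak B(G,r,\vec\rho,u)$ is a central quantum linear space if and only if $\alpha:=(g_2,\dots,g_2)$ lies in $A\subseteq G$, $r=r_CC$ for the class $C=\{\alpha\}$, and for every $i\in I_C$ there are $\delta_1,\dots,\delta_n$ with $\delta_1+\cdots+\delta_n$ odd such that, for the character $\chi=\chi_2^{\delta_1}\otimes\cdots\otimes\chi_2^{\delta_n}$ of $A$ (with $\chi_2$ the character of order two of $C_2$), and some irreducible representation $\mu$ of the stabilizer $(\mathbb S_n^{u(C)})_\chi$, $$\rho_C^{(i)}\cong\theta_{\chi,\mu}:=(\chi\otimes\mu)\uparrow_{G_\chi^{u(C)}}^{G^{u(C)}},\qquad G_\chi^{u(C)}=A\rtimes(\mathbb S_n^{u(C)})_\chi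 .$$ -/

import Mathlib

open scoped TensorProduct DirectSum

universe w

noncomputable section

/-! ### Nichols algebras of braided vector spaces -/

section Nichols

variable {V : Type*} [AddCommGroup V] [Module ℂ V]

/-- If `F : V → T(V)` is "left insertion into `z`", this is left insertion into `y z`:
`v ↦ v y z + ∑ y' F(v')`, where `c (v ⊗ y) = ∑ y' ⊗ v'`. -/
def insertStep (c : V ⊗[ℂ] V →ₗ[ℂ] V ⊗[ℂ] V) (y : V) (z : TensorAlgebra ℂ V)
    (F : V →ₗ[ℂ] TensorAlgebra ℂ V) : V →ₗ[ℂ] TensorAlgebra ℂ V :=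
  LinearMap.mulRight ℂ (TensorAlgebra.ι ℂ y * z) ∘ₗ TensorAlgebra.ι ℂ +
    LinearMap.mul' ℂ (TensorAlgebra ℂ V) ∘ₗ TensorProduct.map (TensorAlgebra.ι ℂ) F ∘ₗ c ∘ₗ
      (TensorProduct.mk ℂ V V).flip y

/-- The linear map `y ↦ ((z, F) ↦ (y z, insertStep c y z F))`. -/
def insertStepHom (c : V ⊗[ℂ] V →ₗ[ℂ] V ⊗[ℂ] V) :
    V →ₗ[ℂ] Module.End ℂ (TensorAlgebra ℂ V × (V →ₗ[ℂ] TensorAlgebra ℂ V)) :=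
  LinearMap.mk₂ ℂ (fun y p => (TensorAlgebra.ι ℂ y * p.1, insertStep c y p.1 p.2))
    (fun y y' p => by
      ext1
      · simp [add_mul]
      · ext v
        simp [insertStep, add_mul, mul_add, mul_assoc]
        abel)
    (fun a y p => by
      ext1
      · simp
      · ext v
        simp [insertStep, mul_assoc])
    (fun y p p' => by
      ext1
      · simp [mul_add]
      · ext v
        simp [insertStep, mul_add, mul_assoc, TensorProduct.map_add_right]
        abel)
    (fun a y p => by
      ext1
      · simp
      · ext v
        simp [insertStep, mul_assoc, TensorProduct.map_smul_right])

/-- Quantum shuffle multiplication by a vector on the left: `quantumInsert c v` maps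
`y₁ ⋯ y_m` to `∑_{k=0}^{m} c_k ⋯ c_2 c_1 (v y₁ ⋯ y_m)`, where `c_i` is the braiding acting on the
tensor factors `i` and `i + 1`. -/
def quantumInsert (c : V ⊗[ℂ] V →ₗ[ℂ] V ⊗[ℂ] V) :
    V →ₗ[ℂ] Module.End ℂ (TensorAlgebra ℂ V) :=
  LinearMap.flip
    (LinearMap.snd ℂ (TensorAlgebra ℂ V) (V →ₗ[ℂ] TensorAlgebra ℂ V) ∘ₗ
      LinearMap.applyₗ ((1 : TensorAlgebra ℂ V), (TensorAlgebra.ι ℂ : V →ₗ[ℂ] TensorAlgebra ℂ V)) ∘ₗ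
        (TensorAlgebra.lift ℂ (insertStepHom c)).toLinearMap)

theorem quantumInsert_one (c : V ⊗[ℂ] V →ₗ[ℂ] V ⊗[ℂ] V) (v : V) :
    quantumInsert c v 1 = TensorAlgebra.ι ℂ v := by
  simp [quantumInsert]

/-- The total quantum symmetrizer `⨁_m S_m` on `T(V)`, where `S_m` is the sum over the symmetric
group on `m` letters of the operators on `V^{⊗ m}` that lift the permutations through the braiding
(`S_0 = 1`, `S_{m+1} = (∑_{k=0}^{m} c_k ⋯ c_1) (id ⊗ S_m)`). -/
def quantumSymmetrizer (c : V ⊗[ℂ] V →ₗ[ℂ] V ⊗[ℂ] V) :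
    TensorAlgebra ℂ V →ₗ[ℂ] TensorAlgebra ℂ V :=
  LinearMap.applyₗ (1 : TensorAlgebra ℂ V) ∘ₗ
    (TensorAlgebra.lift ℂ (quantumInsert c)).toLinearMap

theorem quantumSymmetrizer_one (c : V ⊗[ℂ] V →ₗ[ℂ] V ⊗[ℂ] V) :
    quantumSymmetrizer c 1 = 1 := by
  simp [quantumSymmetrizer]

theorem quantumSymmetrizer_ι_mul (c : V ⊗[ℂ] V →ₗ[ℂ] V ⊗[ℂ] V) (v : V)
    (z : TensorAlgebra ℂ V) :
    quantumSymmetrizer c (TensorAlgebra.ι ℂ v * z) =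
      quantumInsert c v (quantumSymmetrizer c z) := by
  simp [quantumSymmetrizer]

/-- The Nichols algebra `𝔅(V)` of a braided vector space `(V, c)`: the quotient of `T(V)` by the
kernel of the quantum symmetrizers. -/
abbrev NicholsAlgebra (c : V ⊗[ℂ] V →ₗ[ℂ] V ⊗[ℂ] V) : Type _ :=
  RingQuot (fun x y : TensorAlgebra ℂ V => quantumSymmetrizer c x = quantumSymmetrizer c y)

end Nichols

/-- A braiding is quantum symmetric if it is diagonal, `c (x_a ⊗ x_b) = q_{ab} x_b ⊗ x_a` for some
basis `x`, with `q_{ab} q_{ba} = 1` for `a ≠ b`. -/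
def IsQuantumSymmetric {V : Type w} [AddCommGroup V] [Module ℂ V]
    (c : V ⊗[ℂ] V →ₗ[ℂ] V ⊗[ℂ] V) : Prop :=
  ∃ (ι : Type w) (x : Module.Basis ι ℂ V) (q : ι → ι → ℂ),
    (∀ a b, c (x a ⊗ₜ[ℂ] x b) = q a b • (x b ⊗ₜ[ℂ] x a)) ∧
    ∀ a b, a ≠ b → q a b * q b a = 1

/-! ### Ramification systems with irreducible representations -/

/-- A ramification system with irreducible representations `RSR(G, r, ρ⃗, u)` of a group `G`.
The representation `ρ_C = ⨁ i, ρ C i` of the centralizer of `u C` is given through its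
irreducible constituents. For `r C = 0` the condition on degrees forces `I C` to be empty. -/
structure RSR (G : Type*) [Group G] where
  /-- the ramification `r = ∑ r_C C` -/
  r : ConjClasses G → ℕ
  /-- the choice of a representative of each conjugacy class -/
  u : ConjClasses G → G
  u_mem : ∀ C, u C ∈ C.carrier
  /-- the index sets `I_C(r, u)` -/
  I : ConjClasses G → Type w
  /-- the representation spaces -/
  X : ∀ C, I C → Type w
  [fintypeI : ∀ C, Fintype (I C)]
  [addCommGroupX : ∀ C i, AddCommGroup (X C i)]
  [moduleX : ∀ C i, Module ℂ (X C i)]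
  [finiteX : ∀ C i, Module.Finite ℂ (X C i)]
  ρ : ∀ C i, Representation ℂ (Subgroup.centralizer {u C}) (X C i)
  irreducible : ∀ C i, (ρ C i).IsIrreducible
  degree : ∀ C, ∑ i, Module.finrank ℂ (X C i) = r C

attribute [instance] RSR.fintypeI RSR.addCommGroupX RSR.moduleX RSR.finiteX

namespace RSR

variable {G : Type*} [Group G] (R : RSR.{w} G)

/-- The element `u C` of its own centralizer. -/
def uCentralizer (C : ConjClasses G) : Subgroup.centralizer {R.u C} :=
  ⟨R.u C, Subgroup.mem_centralizer_singleton_iff.mpr rfl⟩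

theorem exists_conj {C : ConjClasses G} (t : C.carrier) :
    ∃ h : G, h * R.u C * h⁻¹ = t := by
  have h1 := ConjClasses.mem_carrier_iff_mk_eq.mp (R.u_mem C)
  have h2 := ConjClasses.mem_carrier_iff_mk_eq.mp t.2
  exact isConj_iff.mp (ConjClasses.mk_eq_mk_iff_isConj.mp (h1.trans h2.symm))

/-- For `t` in the class `C`, a chosen element `h_t` with `h_t u(C) h_t⁻¹ = t`. -/
def conjugator {C : ConjClasses G} (t : C.carrier) : G := (R.exists_conj t).choose

theorem conjugator_spec {C : ConjClasses G} (t : C.carrier) :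
    R.conjugator t * R.u C * (R.conjugator t)⁻¹ = t := (R.exists_conj t).choose_spec

/-- The element `h t h⁻¹` of the class of `t`. -/
def conjAct {C : ConjClasses G} (h : G) (t : C.carrier) : C.carrier :=
  ⟨h * t * h⁻¹, by
    have h2 := ConjClasses.mem_carrier_iff_mk_eq.mp t.2
    refine ConjClasses.mem_carrier_iff_mk_eq.mpr (Eq.trans ?_ h2)
    exact ConjClasses.mk_eq_mk_iff_isConj.mpr (isConj_iff.mpr ⟨h, rfl⟩).symm⟩

/-- The element `γ = h_{t'}⁻¹ h h_t` of the centralizer of `u C`, where `t' = h t h⁻¹`. -/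
def cocycle {C : ConjClasses G} (h : G) (t : C.carrier) : Subgroup.centralizer {R.u C} :=
  ⟨(R.conjugator (conjAct h t))⁻¹ * h * R.conjugator t, by
    have h1 := R.conjugator_spec t
    have h2 : R.conjugator (conjAct h t) * R.u C * (R.conjugator (conjAct h t))⁻¹ =
      h * t * h⁻¹ := R.conjugator_spec (conjAct h t)
    rw [← h1] at h2
    rw [Subgroup.mem_centralizer_singleton_iff]
    have h3 := congrArg
      (fun z => (R.conjugator (conjAct h t))⁻¹ * z * (h * R.conjugator t)) h2
    simp only [mul_assoc, inv_mul_cancel_left, inv_mul_cancel, mul_one] at h3 ⊢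
    rw [← h3]⟩

/-- The index set of the summands `h_t ⊗ X C i` of the arrow Yetter-Drinfeld module. -/
abbrev Idx : Type _ := Σ p : (Σ C : ConjClasses G, R.I C), p.1.carrier

/-- The arrow Yetter-Drinfeld module `⨁_{C, i} M(𝒪_{u(C)}, ρ C i)`, where
`M(𝒪_{u(C)}, ρ C i) = ⨁_{t ∈ C} h_t ⊗ X C i`. -/
abbrev ArrowModule : Type _ := ⨁ x : R.Idx, R.X x.1.1 x.1.2

open scoped Classical in
/-- The action of `h ∈ G` on the arrow module: `h (h_t v) = h_{t'} (γ v)`,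
where `h h_t = h_{t'} γ`. -/
def arrowAction (h : G) : R.ArrowModule →ₗ[ℂ] R.ArrowModule :=
  DirectSum.toModule ℂ R.Idx R.ArrowModule fun x =>
    DirectSum.lof ℂ R.Idx (fun x => R.X x.1.1 x.1.2) ⟨x.1, conjAct h x.2⟩ ∘ₗ
      R.ρ x.1.1 x.1.2 (R.cocycle h x.2)

open scoped Classical in
/-- The braiding of the arrow module. As the coaction is `δ (h_t v) = t ⊗ h_t v`, the
Yetter-Drinfeld braiding is `h_t v ⊗ m ↦ t m ⊗ h_t v`. -/
def arrowBraiding :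
    R.ArrowModule ⊗[ℂ] R.ArrowModule →ₗ[ℂ] R.ArrowModule ⊗[ℂ] R.ArrowModule :=
  TensorProduct.lift <| DirectSum.toModule ℂ R.Idx _ fun x =>
    LinearMap.lcomp ℂ (R.ArrowModule ⊗[ℂ] R.ArrowModule) (R.arrowAction (x.2 : G)) ∘ₗ
      (TensorProduct.mk ℂ R.ArrowModule R.ArrowModule).flip ∘ₗ
        DirectSum.lof ℂ R.Idx (fun x => R.X x.1.1 x.1.2) x

/-- The Nichols algebra `𝔅(G, r, ρ⃗, u)`. -/
abbrev Nichols : Type _ := NicholsAlgebra R.arrowBraiding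

/-- An RSR is of the non-essentially infinite type if every operator `ρ_C^{(i)}(u(C))`, which is
a scalar, has finite order different from `1` (`orderOf` is `0` for an infinite order). -/
def IsNonEssentiallyInfinite : Prop :=
  ∀ C (i : R.I C), 1 < orderOf (R.ρ C i (R.uCentralizer C))

/-- Central quantum linear type: quantum symmetric, of the non-essentially infinite type, and
with all conjugacy classes of the ramification contained in the centre. -/
structure IsCentralQuantumLinearType : Prop where
  quantumSymmetric : IsQuantumSymmetric R.arrowBraiding
  nonEssentiallyInfinite : R.IsNonEssentiallyInfinite
  central : ∀ C, R.r C ≠ 0 → C.carrier ⊆ (Subgroup.center G : Set G)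

/-- The Nichols algebra `𝔅(G, r, ρ⃗, u)` is a central quantum linear space: it is a
finite dimensional Nichols algebra, and the RSR is of central quantum linear type. -/
structure IsCentralQuantumLinearSpace : Prop where
  type : R.IsCentralQuantumLinearType
  finite : Module.Finite ℂ R.Nichols

end RSR

/-! ### Classical Weyl groups -/

/-- The families of classical Weyl groups. -/
inductive ClassicalType
  | A
  | B
  | C
  | D

/-- The cyclic group of order two is `ℤˣ = {1, -1}`, with generator `g₂ = -1`. This is the subgroup
`A` of `(C₂)^n`: trivial for type `A`, everything for types `B` and `C`, and the tuples with an
even number of entries `g₂` (equivalently, with product `1`) for type `D`. -/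
def signSubgroup (n : ℕ) : ClassicalType → Subgroup (Fin n → ℤˣ)
  | .A => ⊥
  | .B => ⊤
  | .C => ⊤
  | .D =>
    { carrier := {a | ∏ j, a j = 1}
      one_mem' := by simp
      mul_mem' := by
        intro a b ha hb
        simp only [Set.mem_ofPred_eq, Pi.mul_apply, Finset.prod_mul_distrib] at *
        rw [ha, hb, one_mul]
      inv_mem' := by
        intro a ha
        simp only [Set.mem_ofPred_eq, Pi.inv_apply, Finset.prod_inv_distrib] at *
        rw [ha, inv_one] }

theorem comp_mem_signSubgroup {n : ℕ} {t : ClassicalType} (τ : Equiv.Perm (Fin n))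
    {a : Fin n → ℤˣ} (ha : a ∈ signSubgroup n t) : (a ∘ τ) ∈ signSubgroup n t := by
  cases t with
  | A =>
    have h : a = 1 := ha
    subst h
    exact Subgroup.mem_bot.mpr rfl
  | B => exact Subgroup.mem_top _
  | C => exact Subgroup.mem_top _
  | D =>
    have h : ∏ j, a j = 1 := ha
    change ∏ j, a (τ j) = 1
    rw [← h]
    exact Equiv.prod_comp τ a

/-- The action of the symmetric group on `A`: `(τ · a)_j = a_{τ⁻¹ j}`. -/
def permAction (n : ℕ) (t : ClassicalType) :
    Equiv.Perm (Fin n) →* MulAut (signSubgroup n t) where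
  toFun τ :=
    { toFun := fun a => ⟨fun j => (a : Fin n → ℤˣ) (τ⁻¹ j), comp_mem_signSubgroup τ⁻¹ a.2⟩
      invFun := fun a => ⟨fun j => (a : Fin n → ℤˣ) (τ j), comp_mem_signSubgroup τ a.2⟩
      left_inv := fun a => by ext j; simp
      right_inv := fun a => by ext j; simp
      map_mul' := fun _ _ => rfl }
  map_one' := rfl
  map_mul' _ _ := rfl

/-- The classical Weyl group `A ⋊ 𝕊_n`: it is `W(A_{n-1})` for type `A`, and `W(B_n)`, `W(C_n)`,
`W(D_n)` for the other types. -/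
abbrev ClassicalWeylGroup (t : ClassicalType) (n : ℕ) : Type :=
  signSubgroup n t ⋊[permAction n t] Equiv.Perm (Fin n)

section Theta

variable {t : ClassicalType} {n : ℕ}

/-- The character `χ₂^{δ_1} ⊗ ⋯ ⊗ χ₂^{δ_n}` of `A`, where `χ₂` is the character of order two
of `C₂`, that is, the inclusion of `{1, -1}` into `ℂ`. -/
def signCharacter (t : ClassicalType) {n : ℕ} (δ : Fin n → ℕ) : signSubgroup n t →* ℂ where
  toFun a := ∏ j, ((((a : Fin n → ℤˣ) j : ℤˣ) : ℤ) : ℂ) ^ δ j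
  map_one' := by simp
  map_mul' a b := by simp [mul_pow, Finset.prod_mul_distrib]

/-- The subgroup `(𝕊_n^σ)_χ` of the permutations which commute with `σ` and fix `χ`. -/
def permStabilizer (σ : ClassicalWeylGroup t n) (χ : signSubgroup n t →* ℂ) :
    Subgroup (Equiv.Perm (Fin n)) where
  carrier := {τ | SemidirectProduct.inr τ * σ = σ * SemidirectProduct.inr τ ∧
    ∀ a, χ (permAction n t τ⁻¹ a) = χ a}
  one_mem' := ⟨by rw [map_one, one_mul, mul_one], fun _ => rfl⟩
  mul_mem' := by
    rintro x y ⟨hx, hx'⟩ ⟨hy, hy'⟩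
    refine ⟨?_, fun a => ?_⟩
    · rw [map_mul, mul_assoc, hy, ← mul_assoc, hx, mul_assoc]
    · rw [mul_inv_rev, map_mul, MulAut.mul_apply, hy', hx']
  inv_mem' := by
    rintro x ⟨hx, hx'⟩
    refine ⟨?_, fun a => ?_⟩
    · rw [map_inv]
      exact inv_mul_eq_of_eq_mul (by rw [← mul_assoc, hx, mul_assoc, mul_inv_cancel, mul_one])
    · rw [inv_inv, ← hx' (permAction n t x a), ← MulAut.mul_apply, ← map_mul]
      simp

/-- The subgroup `(G^σ)_χ = A ⋊ (𝕊_n^σ)_χ` of the centralizer `G^σ`, for `σ ∈ A`. -/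
def centralizerStabilizer (σ : ClassicalWeylGroup t n) (χ : signSubgroup n t →* ℂ) :
    Subgroup (Subgroup.centralizer {σ}) :=
  (permStabilizer σ χ).comap (SemidirectProduct.rightHom.comp (Subgroup.subtype _))

/-- The representation `χ ⊗ μ` of `(G^σ)_χ`, `(a, τ) ↦ χ(a) μ(τ)`. -/
def tensorCharacter (σ : ClassicalWeylGroup t n) (χ : signSubgroup n t →* ℂ)
    {W : Type*} [AddCommGroup W] [Module ℂ W]
    (μ : Representation ℂ (permStabilizer σ χ) W) :
    Representation ℂ (centralizerStabilizer σ χ) W where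
  toFun x := χ (x : ClassicalWeylGroup t n).left • μ ⟨(x : ClassicalWeylGroup t n).right, x.2⟩
  map_one' := by
    have h : (⟨((1 : centralizerStabilizer σ χ) : ClassicalWeylGroup t n).right,
      (1 : centralizerStabilizer σ χ).2⟩ : permStabilizer σ χ) = 1 := rfl
    rw [h, map_one]
    simp
  map_mul' x y := by
    have h : (⟨((x * y : centralizerStabilizer σ χ) : ClassicalWeylGroup t n).right,
      (x * y).2⟩ : permStabilizer σ χ) =
      ⟨(x : ClassicalWeylGroup t n).right, x.2⟩ * ⟨(y : ClassicalWeylGroup t n).right, y.2⟩ := rfl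
    have h2 : χ (permAction n t (x : ClassicalWeylGroup t n).right
        (y : ClassicalWeylGroup t n).left) = χ (y : ClassicalWeylGroup t n).left := by
      have h3 := ((permStabilizer σ χ).inv_mem x.2).2 (y : ClassicalWeylGroup t n).left
      rw [inv_inv] at h3
      exact h3
    rw [h, map_mul]
    simp only [Subgroup.coe_mul, SemidirectProduct.mul_left, map_mul, h2]
    rw [smul_mul_smul_comm]

/-- The representation `θ_{χ, μ} = (χ ⊗ μ) ↑_{(G^σ)_χ}^{G^σ}` of the centralizer `G^σ`. -/
def theta (σ : ClassicalWeylGroup t n) (χ : signSubgroup n t →* ℂ)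
    {W : Type*} [AddCommGroup W] [Module ℂ W]
    (μ : Representation ℂ (permStabilizer σ χ) W) :=
  Representation.ind (centralizerStabilizer σ χ).subtype (tensorCharacter σ χ μ)

end Theta

end

/-! For n > 2 the centre of G contains at most one element besides 1, the tuple α = (g₂, …, g₂),
because a central element must have trivial permutation part and constant signs. A class in the
ramification of a central quantum linear space is central, and it is not {1}, since the identity
would act with order 1. Hence it is {α}. As α is a central involution it acts on an irreducible
representation by 1 or -1, and the order condition leaves -1
(`Representation.IsIrreducible.eq_one_or_eq_neg_one`).

Clifford theory turns this into the statement about θ. Some sign character χ of A occurs in ρ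
(`exists_characterSpace_signCharacter_ne_bot`). The χ-space is an irreducible representation of the
stabilizer of χ, and ρ is induced from it (`nonempty_equiv_theta`). Evaluating χ at α gives (-1)^(∑
δ_j) = -1, so the sum is odd.

Conversely, oddness makes α act by -1 on every θ (`theta_apply_eq_neg_one`), so the braiding of the
whole module is minus the flip. The Nichols algebra is then a quotient of the exterior algebra of a
finite dimensional space (`NicholsAlgebra.finite_of_neg_flip`). -/

noncomputable section

/-! ### Clifford theory for a crossed module of finite groups -/

section Clifford

variable {G A V : Type*} [Group G] [Group A] [AddCommGroup V] [Module ℂ V]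

/-- The subspace of a representation on which a group `A` mapping to `G` acts through `χ`. -/
def characterSpace (ρ : Representation ℂ G V) (j : A →* G) (χ : A →* ℂ) : Submodule ℂ V where
  carrier := {v | ∀ a, ρ (j a) v = χ a • v}
  add_mem' hx hy a := by rw [map_add, hx a, hy a, smul_add]
  zero_mem' a := by simp
  smul_mem' c x hx a := by rw [map_smul, hx a, smul_comm]

theorem mem_characterSpace {ρ : Representation ℂ G V} {j : A →* G} {χ : A →* ℂ} {v : V} :
    v ∈ characterSpace ρ j χ ↔ ∀ a, ρ (j a) v = χ a • v := Iff.rfl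

theorem MonoidHom.apply_inv_mul_apply (χ : A →* ℂ) (a : A) : χ a⁻¹ * χ a = 1 := by
  rw [← map_mul, inv_mul_cancel, map_one]

section Projection

variable [Fintype A]

/-- The projection of a representation onto `characterSpace ρ j χ`. -/
def characterProjection (ρ : Representation ℂ G V) (j : A →* G) (χ : A →* ℂ) : V →ₗ[ℂ] V :=
  (Fintype.card A : ℂ)⁻¹ • ∑ a, χ a⁻¹ • ρ (j a)

theorem characterProjection_apply (ρ : Representation ℂ G V) (j : A →* G) (χ : A →* ℂ) (v : V) :
    characterProjection ρ j χ v = (Fintype.card A : ℂ)⁻¹ • ∑ a, χ a⁻¹ • ρ (j a) v := by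
  simp [characterProjection, LinearMap.sum_apply]

theorem apply_characterProjection (ρ : Representation ℂ G V) (j : A →* G) (χ : A →* ℂ)
    (b : A) (v : V) :
    ρ (j b) (characterProjection ρ j χ v) = χ b • characterProjection ρ j χ v := by
  rw [characterProjection_apply, map_smul, map_sum, smul_comm (χ b)]
  congr 1
  rw [Finset.smul_sum]
  refine Fintype.sum_equiv (Equiv.mulLeft b) _ _ fun a => ?_
  rw [map_smul, Equiv.coe_mulLeft, map_mul, map_mul, Module.End.mul_apply, smul_smul,
    mul_inv_rev, map_mul, mul_left_comm, mul_comm (χ b), χ.apply_inv_mul_apply, mul_one]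

theorem characterProjection_mem (ρ : Representation ℂ G V) (j : A →* G) (χ : A →* ℂ) (v : V) :
    characterProjection ρ j χ v ∈ characterSpace ρ j χ :=
  fun b => apply_characterProjection ρ j χ b v

theorem characterProjection_of_mem {ρ : Representation ℂ G V} {j : A →* G} {χ : A →* ℂ} {v : V}
    (hv : v ∈ characterSpace ρ j χ) : characterProjection ρ j χ v = v := by
  rw [characterProjection_apply]
  have h : ∀ a, χ a⁻¹ • ρ (j a) v = v := fun a => by
    rw [hv a, smul_smul, χ.apply_inv_mul_apply, one_smul]
  simp only [h, Finset.sum_const, Finset.card_univ]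
  rw [← Nat.cast_smul_eq_nsmul ℂ, smul_smul, inv_mul_cancel₀ (by simp), one_smul]

/-- The projection P satisfies P ∘ ρ(j b) = χ(b) P. On a vector v of the χ'-space this gives χ(b) P
v = χ'(b) P v for all b, so P v ≠ 0 would force χ = χ'. -/
theorem characterProjection_eq_zero {ρ : Representation ℂ G V} {j : A →* G} {χ χ' : A →* ℂ}
    (hχ : χ ≠ χ') {v : V} (hv : v ∈ characterSpace ρ j χ') :
    characterProjection ρ j χ v = 0 := by
  by_contra h0
  refine hχ (MonoidHom.ext fun b => ?_)
  refine smul_left_injective ℂ h0 ?_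
  change χ b • _ = χ' b • _
  rw [← (characterProjection ρ j χ).map_smul (χ' b), ← hv b, characterProjection_apply, characterProjection_apply,
    smul_comm (χ b)]
  congr 1
  rw [Finset.smul_sum]
  refine Fintype.sum_equiv (Equiv.mulRight b⁻¹) _ _ fun a => ?_
  rw [Equiv.coe_mulRight, smul_smul, ← Module.End.mul_apply, ← map_mul, ← map_mul, ← map_mul,
    inv_mul_cancel_right, mul_inv_rev, inv_inv]

end Projection

variable {ρ : Representation ℂ G V} {j : A →* G} {χ : A →* ℂ} {c : G → A →* A} {H : Subgroup G}

/-- An element of `G` moves the `χ`-space to the space of a conjugate of `χ`. -/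
theorem apply_mem_characterSpace_comp (hc : ∀ g a, j (c g a) = g * j a * g⁻¹) (g : G) {w : V}
    (hw : w ∈ characterSpace ρ j χ) : ρ g w ∈ characterSpace ρ j (χ.comp (c g⁻¹)) := fun a => by
  have h : j a * g = g * j (c g⁻¹ a) := by rw [hc]; group
  rw [← Module.End.mul_apply, ← map_mul, h, map_mul, Module.End.mul_apply, hw, map_smul]
  rfl

theorem apply_mem_characterSpace (hc : ∀ g a, j (c g a) = g * j a * g⁻¹)
    (hH : ∀ g, g ∈ H ↔ ∀ a, χ (c g a) = χ a) {g : G} (hg : g ∈ H) {w : V}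
    (hw : w ∈ characterSpace ρ j χ) : ρ g w ∈ characterSpace ρ j χ := by
  have h : χ.comp (c g⁻¹) = χ := MonoidHom.ext fun a => (hH g⁻¹).1 (H.inv_mem hg) a
  exact h ▸ apply_mem_characterSpace_comp hc g hw

/-- An element outside the stabilizer carries the χ-space into the space of a different character,
which the projection kills. -/
theorem characterProjection_apply_of_notMem [Fintype A] (hc : ∀ g a, j (c g a) = g * j a * g⁻¹)
    (hH : ∀ g, g ∈ H ↔ ∀ a, χ (c g a) = χ a) {g : G} (hg : g ∉ H) {w : V}
    (hw : w ∈ characterSpace ρ j χ) : characterProjection ρ j χ (ρ g w) = 0 := by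
  refine characterProjection_eq_zero (fun h => hg ?_) (apply_mem_characterSpace_comp hc g hw)
  refine inv_mem_iff.1 ((hH g⁻¹).2 fun a => ?_)
  exact (DFunLike.congr_fun h a).symm

/-- The subspaces of the `χ`-space of an irreducible representation that are stable under the
stabilizer of `χ` are trivial. -/
theorem eq_bot_or_eq_of_le_characterSpace [Finite A] [ρ.IsIrreducible]
    (hc : ∀ g a, j (c g a) = g * j a * g⁻¹)
    (hH : ∀ g, g ∈ H ↔ ∀ a, χ (c g a) = χ a) {U : Submodule ℂ V}
    (hU : U ≤ characterSpace ρ j χ) (hUH : ∀ g ∈ H, ∀ u ∈ U, ρ g u ∈ U) :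
    U = ⊥ ∨ U = characterSpace ρ j χ := by
  have := Fintype.ofFinite A
  -- The subrepresentation generated by U is zero or everything.
  let S : Subrepresentation ρ :=
    { toSubmodule := ⨆ g, U.map (ρ g)
      apply_mem_toSubmodule := fun g v hv => by
        have h : (⨆ g, U.map (ρ g)) ≤ (⨆ g, U.map (ρ g)).comap (ρ g) := by
          refine iSup_le fun k => ?_
          rintro _ ⟨u, hu, rfl⟩
          refine Submodule.mem_iSup_of_mem (g * k) ⟨u, hu, ?_⟩
          rw [map_mul, Module.End.mul_apply]
        exact h hv }
  rcases eq_bot_or_eq_top S with hS | hS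
  · left
    refine eq_bot_iff.2 fun u hu => ?_
    have h : u ∈ S := Submodule.mem_iSup_of_mem (1 : G) ⟨u, hu, by simp⟩
    rw [hS] at h
    exact h
  · right
    refine le_antisymm hU fun w hw => ?_
    -- Projecting a translate gU to the χ-space gives back gU ⊆ U for g in H and zero otherwise, so
    -- all of S projects into U.
    have h : S.toSubmodule ≤ U.comap (characterProjection ρ j χ) := by
      refine iSup_le fun g => ?_
      rintro _ ⟨u, hu, rfl⟩
      rw [Submodule.mem_comap]
      by_cases hg : g ∈ H
      · rw [characterProjection_of_mem (hU (hUH g hg u hu))]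
        exact hUH g hg u hu
      · rw [characterProjection_apply_of_notMem hc hH hg (hU hu)]
        exact zero_mem _
    have h2 : w ∈ S.toSubmodule := by rw [hS]; exact Submodule.mem_top
    rw [← characterProjection_of_mem hw]
    exact h h2

/-- This is the relation imposed by the coinvariants that define the induced module. -/
theorem Representation.IndV.mk_mul_apply {W : Type*} [AddCommGroup W] [Module ℂ W]
    (τ : Representation ℂ H W) (h : H) (g : G) (w : W) :
    Representation.IndV.mk H.subtype τ (h * g) (τ h w) =
      Representation.IndV.mk H.subtype τ g w := by
  have := Representation.Coinvariants.mk_self_apply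
    (Representation.tprod ((Representation.leftRegular ℂ G).comp H.subtype) τ) h
    (MonoidAlgebra.single g 1 ⊗ₜ[ℂ] w)
  simpa using this

/-- The linear map out of an induced representation attached to an intertwining map into a
restriction. -/
def Representation.IndV.lift {W : Type*} [AddCommGroup W] [Module ℂ W]
    (τ : Representation ℂ H W) (ρ : Representation ℂ G V) (f : W →ₗ[ℂ] V)
    (hf : ∀ h w, f (τ h w) = ρ h (f w)) :
    Representation.IndV H.subtype τ →ₗ[ℂ] V :=
  Representation.Coinvariants.lift _
    -- The inverse appears because g acts on `mk k w` by k ↦ k g⁻¹, so `mk g w` stands for the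
    -- translate of w by g⁻¹.
    (TensorProduct.lift <| (Finsupp.lift _ _ _ fun g => ρ g⁻¹ ∘ₗ f) ∘ₗ
      (MonoidAlgebra.coeffLinearEquiv ℂ).toLinearMap) fun h => by
    ext g x
    simp only [LinearMap.coe_comp, Function.comp_apply, MonoidAlgebra.lsingle_apply]
    simp [hf]

theorem Representation.IndV.lift_mk {W : Type*} [AddCommGroup W] [Module ℂ W]
    (τ : Representation ℂ H W) (ρ : Representation ℂ G V) (f : W →ₗ[ℂ] V)
    (hf : ∀ h w, f (τ h w) = ρ h (f w)) (g : G) (w : W) :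
    Representation.IndV.lift τ ρ f hf (Representation.IndV.mk H.subtype τ g w) =
      ρ g⁻¹ (f w) := by
  simp [Representation.IndV.lift]

theorem Representation.IndV.lift_ind {W : Type*} [AddCommGroup W] [Module ℂ W]
    (τ : Representation ℂ H W) (ρ : Representation ℂ G V) (f : W →ₗ[ℂ] V)
    (hf : ∀ h w, f (τ h w) = ρ h (f w)) (g : G) :
    Representation.IndV.lift τ ρ f hf ∘ₗ Representation.ind H.subtype τ g =
      ρ g ∘ₗ Representation.IndV.lift τ ρ f hf := by
  refine Representation.IndV.hom_ext _ _ fun k => LinearMap.ext fun w => ?_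
  change Representation.IndV.lift τ ρ f hf (Representation.ind H.subtype τ g
    (Representation.IndV.mk H.subtype τ k w)) =
      ρ g (Representation.IndV.lift τ ρ f hf (Representation.IndV.mk H.subtype τ k w))
  rw [Representation.ind_mk, Representation.IndV.lift_mk, Representation.IndV.lift_mk, mul_inv_rev,
    inv_inv, map_mul, Module.End.mul_apply]

/-- The map `v ↦ |H|⁻¹ ∑ g, g ⊗ p (g v)`, for a linear map `p`. -/
def Representation.IndV.average {W : Type*} [AddCommGroup W] [Module ℂ W] [Fintype G]
    (τ : Representation ℂ H W) (ρ : Representation ℂ G V) (p : V →ₗ[ℂ] W) :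
    V →ₗ[ℂ] Representation.IndV H.subtype τ :=
  (Nat.card H : ℂ)⁻¹ • ∑ g, Representation.IndV.mk H.subtype τ g ∘ₗ p ∘ₗ ρ g

/-- Evaluated at the image of `mk k w` and reindexed by g ↦ g k, the sum loses all terms with g ∉ H.
The |H| surviving terms all equal `mk k w`, which accounts for the normalization. -/
theorem Representation.IndV.average_lift {W : Type*} [AddCommGroup W] [Module ℂ W] [Fintype G]
    (τ : Representation ℂ H W) (ρ : Representation ℂ G V) (f : W →ₗ[ℂ] V)
    (hf : ∀ h w, f (τ h w) = ρ h (f w)) (p : V →ₗ[ℂ] W) (hp : ∀ w, p (f w) = w)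
    (hpH : ∀ g ∉ H, ∀ w, p (ρ g (f w)) = 0) :
    Representation.IndV.average τ ρ p ∘ₗ Representation.IndV.lift τ ρ f hf = LinearMap.id := by
  classical
  refine Representation.IndV.hom_ext _ _ fun k => LinearMap.ext fun w => ?_
  rw [LinearMap.comp_apply, LinearMap.comp_apply, Representation.IndV.lift_mk, LinearMap.id_comp,
    Representation.IndV.average, LinearMap.smul_apply, LinearMap.sum_apply]
  have h1 : ∀ g : G, (Representation.IndV.mk H.subtype τ (g * k) ∘ₗ p ∘ₗ ρ (g * k))
      (ρ k⁻¹ (f w)) = if g ∈ H then Representation.IndV.mk H.subtype τ k w else 0 := fun g => by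
    have h2 : ρ (g * k) (ρ k⁻¹ (f w)) = ρ g (f w) := by
      rw [← Module.End.mul_apply, ← map_mul, mul_inv_cancel_right]
    change Representation.IndV.mk H.subtype τ (g * k) (p (ρ (g * k) (ρ k⁻¹ (f w)))) = _
    rw [h2]
    split_ifs with hg
    · have h3 := hf ⟨g, hg⟩ w
      rw [← h3, hp]
      exact Representation.IndV.mk_mul_apply τ ⟨g, hg⟩ k w
    · rw [hpH g hg, map_zero]
  rw [← Equiv.sum_comp (Equiv.mulRight k)]
  simp only [Equiv.coe_mulRight, h1]
  rw [← Finset.sum_filter, Finset.sum_const, ← Nat.cast_smul_eq_nsmul ℂ, smul_smul,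
    ← Fintype.card_subtype, ← Nat.card_eq_fintype_card]
  have h4 : Nat.card { x // x ∈ H } ≠ 0 := Nat.card_pos.ne'
  rw [inv_mul_cancel₀ (Nat.cast_ne_zero.2 h4), one_smul]

/-- An irreducible representation is induced from the stabilizer of a character `χ` acting on the
`χ`-space, if the latter is nonzero. -/
theorem nonempty_equiv_ind_characterSpace [Finite G] [Finite A] [ρ.IsIrreducible]
    (hc : ∀ g a, j (c g a) = g * j a * g⁻¹) (hH : ∀ g, g ∈ H ↔ ∀ a, χ (c g a) = χ a)
    (h0 : characterSpace ρ j χ ≠ ⊥) (τ : Representation ℂ H (characterSpace ρ j χ))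
    (hτ : ∀ h w, (τ h w : V) = ρ h w) :
    Nonempty (ρ.Equiv (Representation.ind H.subtype τ)) := by
  have := Fintype.ofFinite A
  have := Fintype.ofFinite G
  let Φ := Representation.IndV.lift τ ρ (characterSpace ρ j χ).subtype hτ
  let p : V →ₗ[ℂ] characterSpace ρ j χ :=
    (characterProjection ρ j χ).codRestrict _ (characterProjection_mem ρ j χ)
  have hinj : Function.Injective Φ := by
    refine Function.LeftInverse.injective (g := Representation.IndV.average τ ρ p) fun x => ?_
    refine LinearMap.congr_fun (Representation.IndV.average_lift τ ρ _ hτ p ?_ ?_) x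
    · exact fun w => Subtype.ext (characterProjection_of_mem w.2)
    · exact fun g hg w => Subtype.ext (characterProjection_apply_of_notMem hc hH hg w.2)
  let F : Representation.IntertwiningMap (Representation.ind H.subtype τ) ρ :=
    ⟨Φ, Representation.IndV.lift_ind τ ρ _ hτ⟩
  -- Irreducibility of the target suffices: a nonzero intertwining map into ρ is onto.
  have hsurj : Function.Surjective Φ := by
    refine (Representation.IsIrreducible.surjective_or_eq_zero F).resolve_right fun hF => ?_
    obtain ⟨w, hw, hw0⟩ := Submodule.exists_mem_ne_zero_of_ne_bot h0
    have h1 : Φ (Representation.IndV.mk H.subtype τ 1 ⟨w, hw⟩) = w := by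
      refine (Representation.IndV.lift_mk τ ρ _ hτ 1 _).trans ?_
      rw [inv_one, map_one]
      rfl
    have h2 : Φ (Representation.IndV.mk H.subtype τ 1 ⟨w, hw⟩) = 0 :=
      congrArg (fun F : Representation.IntertwiningMap _ _ =>
        F (Representation.IndV.mk H.subtype τ 1 ⟨w, hw⟩)) hF
    exact hw0 (h1.symm.trans h2)
  exact ⟨(F.ofBijective ⟨hinj, hsurj⟩).symm⟩

/-- A central element acts on an induced representation through its action on the inducing
representation. -/
theorem Representation.ind_apply_of_central {W : Type*} [AddCommGroup W] [Module ℂ W]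
    (τ : Representation ℂ H W) (z : H) (hz : (z : G) ∈ Subgroup.center G) {s : ℂ}
    (hs : ∀ w, τ z w = s • w) :
    Representation.ind H.subtype τ z = s • LinearMap.id := by
  refine Representation.IndV.hom_ext _ _ fun k => LinearMap.ext fun w => ?_
  change Representation.ind H.subtype τ z (Representation.IndV.mk H.subtype τ k w) =
    s • Representation.IndV.mk H.subtype τ k w
  -- z sends `mk k w` to `mk (k z⁻¹) w`; multiplying on the left by z in the coinvariants restores k
  -- and turns w into τ(z) w.
  rw [Representation.ind_mk, ← Representation.IndV.mk_mul_apply τ z, hs,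
    (Subgroup.mem_center_iff.1 (Subgroup.inv_mem _ hz) k), mul_inv_cancel_left]
  exact map_smul _ _ _

/-- A central involution acts on an irreducible representation as `1` or as `-1`. -/
theorem Representation.IsIrreducible.eq_one_or_eq_neg_one [ρ.IsIrreducible] {z : G}
    (hz : z ∈ Subgroup.center G) (hz2 : z * z = 1) : ρ z = 1 ∨ ρ z = -1 := by
  have hsq : ρ z * ρ z = 1 := by rw [← map_mul, hz2, map_one]
  -- ρ(z) - 1 is an intertwining map, hence injective or zero. If it is injective, (ρ(z) - 1)(ρ(z) +
  -- 1) = 0 forces ρ(z) = -1.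
  let F : Representation.IntertwiningMap ρ ρ := ⟨ρ z - 1, fun g => by
    change (ρ z - 1) * ρ g = ρ g * (ρ z - 1)
    rw [sub_mul, mul_sub, ← map_mul, ← map_mul, Subgroup.mem_center_iff.1 hz g, one_mul, mul_one]⟩
  rcases Representation.IsIrreducible.injective_or_eq_zero F with h | h
  · right
    refine LinearMap.ext fun v => ?_
    have h1 : (ρ z - 1) ((ρ z + 1) v) = (ρ z - 1) 0 := by
      rw [← Module.End.mul_apply, map_zero, sub_mul, mul_add, hsq]
      simp [add_comm]
    have h2 : (ρ z + 1) v = 0 := h h1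
    exact eq_neg_of_add_eq_zero_left h2
  · left
    have h1 : ρ z - 1 = 0 := congrArg Representation.IntertwiningMap.toLinearMap h
    exact sub_eq_zero.1 h1

end Clifford

/-! ### Nichols algebras of minus the flip -/

section ExteriorAlgebra

variable {V : Type*} [AddCommGroup V] [Module ℂ V]

/-- Exterior powers above the dimension vanish, so the grading reduces to a finite sum of finite
dimensional pieces. -/
theorem ExteriorAlgebra.finite_of_finite [Module.Finite ℂ V] :
    Module.Finite ℂ (ExteriorAlgebra ℂ V) := by
  have h1 : ∀ i, Module.finrank ℂ V < i → ⋀[ℂ]^i V = ⊥ := fun i hi => by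
    rw [← Submodule.finrank_eq_zero, exteriorPower.finrank_eq, Nat.choose_eq_zero_of_lt hi]
  have h2 : (⨆ i : Fin (Module.finrank ℂ V + 1), ⋀[ℂ]^(i : ℕ) V) = ⊤ := by
    rw [eq_top_iff, ← (DirectSum.Decomposition.isInternal
      (fun i : ℕ => ⋀[ℂ]^i V)).submodule_iSup_eq_top]
    refine iSup_le fun i => ?_
    rcases lt_or_ge (Module.finrank ℂ V) i with hi | hi
    · rw [h1 i hi]
      exact bot_le
    · exact le_iSup (fun i : Fin (Module.finrank ℂ V + 1) => ⋀[ℂ]^(i : ℕ) V)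
        ⟨i, Nat.lt_succ_of_le hi⟩
  rw [Module.finite_def, ← h2]
  exact Submodule.fg_iSup _ fun i => Module.Finite.iff_fg.1 inferInstance

/-- In degree two the quantum symmetrizer is 1 + c. This is the only degree needed to find the
relations v² = 0. -/
theorem quantumSymmetrizer_ι_mul_ι (c : V ⊗[ℂ] V →ₗ[ℂ] V ⊗[ℂ] V) (v y : V) :
    quantumSymmetrizer c (TensorAlgebra.ι ℂ v * TensorAlgebra.ι ℂ y) =
      TensorAlgebra.ι ℂ v * TensorAlgebra.ι ℂ y +
        LinearMap.mul' ℂ (TensorAlgebra ℂ V)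
          (TensorProduct.map (TensorAlgebra.ι ℂ) (TensorAlgebra.ι ℂ) (c (v ⊗ₜ y))) := by
  rw [quantumSymmetrizer_ι_mul]
  have h : quantumSymmetrizer c (TensorAlgebra.ι ℂ y) = TensorAlgebra.ι ℂ y := by
    rw [← mul_one (TensorAlgebra.ι ℂ y), quantumSymmetrizer_ι_mul, quantumSymmetrizer_one,
      quantumInsert_one, mul_one]
  rw [h]
  simp [quantumInsert, insertStepHom, insertStep]

/-- The Nichols algebra of the negative of the flip is finite dimensional. -/
theorem NicholsAlgebra.finite_of_neg_flip [Module.Finite ℂ V] (c : V ⊗[ℂ] V →ₗ[ℂ] V ⊗[ℂ] V)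
    (hc : ∀ x y, c (x ⊗ₜ y) = -(y ⊗ₜ x)) : Module.Finite ℂ (NicholsAlgebra c) := by
  have := ExteriorAlgebra.finite_of_finite (V := V)
  let π : TensorAlgebra ℂ V →ₐ[ℂ] NicholsAlgebra c := RingQuot.mkAlgHom ℂ _
  -- (1 + c)(v ⊗ v) = 0, so the relations of the exterior algebra hold in the quotient.
  have hsq : ∀ v, (π.toLinearMap ∘ₗ TensorAlgebra.ι ℂ) v *
      (π.toLinearMap ∘ₗ TensorAlgebra.ι ℂ) v = 0 := fun v => by
    change π (TensorAlgebra.ι ℂ v) * π (TensorAlgebra.ι ℂ v) = 0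
    rw [← map_mul, ← map_zero π]
    refine RingQuot.mkAlgHom_rel ℂ ?_
    rw [quantumSymmetrizer_ι_mul_ι, hc, map_zero]
    simp
  let f : ExteriorAlgebra ℂ V →ₐ[ℂ] NicholsAlgebra c := ExteriorAlgebra.lift ℂ ⟨_, hsq⟩
  have hf : f.comp TensorAlgebra.toExterior = π := by
    ext v
    simp [f]
  refine Module.Finite.of_surjective f.toLinearMap fun x => ?_
  obtain ⟨y, rfl⟩ := RingQuot.mkAlgHom_surjective ℂ _ x
  exact ⟨TensorAlgebra.toExterior y, DFunLike.congr_fun hf y⟩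

theorem IsQuantumSymmetric.of_neg_flip {V : Type w} [AddCommGroup V] [Module ℂ V]
    (c : V ⊗[ℂ] V →ₗ[ℂ] V ⊗[ℂ] V)
    (hc : ∀ x y, c (x ⊗ₜ y) = -(y ⊗ₜ x)) : IsQuantumSymmetric c :=
  ⟨_, Module.Basis.ofVectorSpace ℂ V, fun _ _ => -1, fun a b => by rw [hc, neg_one_smul],
    fun _ _ _ => by norm_num⟩

end ExteriorAlgebra

theorem eq_zero_of_eq_neg_self {V : Type*} [AddCommGroup V] [Module ℂ V] {v : V} (h : v = -v) :
    v = 0 := by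
  have h2 : (2 : ℂ) • v = 0 := by
    rw [two_smul]
    nth_rw 2 [h]
    exact add_neg_cancel v
  exact (smul_eq_zero.1 h2).resolve_left two_ne_zero

/-! ### Ramification concentrated in one central class -/

namespace RSR

variable {G : Type*} [Group G] (R : RSR.{w} G)

/-- Irreducible representations are nonzero, so degrees summing to zero leave no constituent. -/
theorem isEmpty_I {C : ConjClasses G} (hC : R.r C = 0) : IsEmpty (R.I C) := by
  refine ⟨fun i => ?_⟩
  have h1 : Module.finrank ℂ (R.X C i) = 0 :=
    Finset.sum_eq_zero_iff.1 ((R.degree C).trans hC) i (Finset.mem_univ i)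
  have h2 := Module.finrank_zero_iff.1 h1
  have h3 := R.irreducible C i
  refine bot_ne_top (α := Subrepresentation (R.ρ C i)) ?_
  refine Subrepresentation.toSubmodule_injective (Submodule.ext fun x => ?_)
  rw [Subsingleton.elim x 0]
  exact ⟨fun _ => zero_mem _, fun _ => zero_mem _⟩

theorem nontrivial_X (C : ConjClasses G) (i : R.I C) : Nontrivial (R.X C i) := by
  have h3 := R.irreducible C i
  by_contra h
  rw [not_nontrivial_iff_subsingleton] at h
  refine bot_ne_top (α := Subrepresentation (R.ρ C i)) ?_
  refine Subrepresentation.toSubmodule_injective (Submodule.ext fun x => ?_)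
  rw [Subsingleton.elim x 0]
  exact ⟨fun _ => zero_mem _, fun _ => zero_mem _⟩

theorem nonempty_I {C : ConjClasses G} (hC : R.r C ≠ 0) : Nonempty (R.I C) := by
  by_contra h
  rw [not_nonempty_iff] at h
  exact hC ((R.degree C).symm.trans (by simp))

open scoped Classical in
theorem arrowBraiding_lof_tmul (x : R.Idx) (v : R.X x.1.1 x.1.2) (m : R.ArrowModule) :
    R.arrowBraiding (DirectSum.lof ℂ R.Idx (fun x => R.X x.1.1 x.1.2) x v ⊗ₜ m) =
      R.arrowAction x.2 m ⊗ₜ DirectSum.lof ℂ R.Idx (fun x => R.X x.1.1 x.1.2) x v := by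
  simp [arrowBraiding]

theorem cocycle_of_central {C : ConjClasses G} {z : G} (hz : z ∈ Subgroup.center G)
    (t : C.carrier) : (R.cocycle z t : G) = z := by
  have h : conjAct z t = t := Subtype.ext (by
    change z * t * z⁻¹ = t
    rw [← Subgroup.mem_center_iff.1 hz, mul_inv_cancel_right])
  change (R.conjugator (conjAct z t))⁻¹ * z * R.conjugator t = z
  rw [h, Subgroup.mem_center_iff.1 hz, inv_mul_cancel_right]

open scoped Classical in
/-- If the ramification is concentrated in a central class `{α}`, and `α` acts by `-1` on all the
representations, then it acts by `-1` on the arrow module. -/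
theorem arrowAction_eq_neg {C : ConjClasses G} {α : G} (hα : α ∈ Subgroup.center G)
    (hC : R.u C = α) (hr : ∀ C', C' ≠ C → R.r C' = 0)
    (hρ : ∀ i, R.ρ C i (R.uCentralizer C) = -1) (m : R.ArrowModule) :
    R.arrowAction α m = -m := by
  suffices h : R.arrowAction α = -LinearMap.id by rw [h]; rfl
  refine DirectSum.linearMap_ext ℂ fun x => LinearMap.ext fun v => ?_
  obtain ⟨⟨C', i⟩, t⟩ := x
  have hC' : C' = C := by
    by_contra hne
    exact (R.isEmpty_I (hr C' hne)).elim i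
  subst hC'
  have h1 : R.cocycle α t = R.uCentralizer C' :=
    Subtype.ext ((R.cocycle_of_central hα t).trans hC.symm)
  have h2 : conjAct α t = t := Subtype.ext (by
    change α * t * α⁻¹ = t
    rw [← Subgroup.mem_center_iff.1 hα, mul_inv_cancel_right])
  -- α fixes the index t only propositionally. The fibre does not depend on t, so v can be kept
  -- while the index is generalized.
  have h3 : ∀ s : C'.carrier, s = t →
      DirectSum.lof ℂ R.Idx (fun x => R.X x.1.1 x.1.2) ⟨⟨C', i⟩, s⟩ v =
        DirectSum.lof ℂ R.Idx (fun x => R.X x.1.1 x.1.2) ⟨⟨C', i⟩, t⟩ v := by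
    rintro _ rfl
    rfl
  simpa [arrowAction, h1, hρ] using h3 _ h2

/-- Every vector has degree α, so the braiding sends x ⊗ y to αy ⊗ x, and α acts by -1. -/
theorem arrowBraiding_eq_neg_flip {C : ConjClasses G} {α : G} (hα : α ∈ Subgroup.center G)
    (hC : C.carrier = {α}) (hr : ∀ C', C' ≠ C → R.r C' = 0)
    (hρ : ∀ i, R.ρ C i (R.uCentralizer C) = -1) (x y : R.ArrowModule) :
    R.arrowBraiding (x ⊗ₜ y) = -(y ⊗ₜ x) := by
  classical
  have hu : R.u C = α := by
    have := R.u_mem C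
    rwa [hC] at this
  induction x using DirectSum.induction_on with
  | zero => simp
  | add x x' hx hx' => rw [TensorProduct.add_tmul, map_add, hx, hx', TensorProduct.tmul_add, neg_add]
  | of x v =>
    obtain ⟨⟨C', i⟩, t⟩ := x
    have hC' : C' = C := by
      by_contra hne
      exact (R.isEmpty_I (hr C' hne)).elim i
    subst hC'
    have ht : (t : G) = α := by
      have h : (t : G) ∈ ({α} : Set G) := hC ▸ t.2
      exact h
    refine (R.arrowBraiding_lof_tmul ⟨⟨C', i⟩, t⟩ v y).trans ?_
    change R.arrowAction (t : G) y ⊗ₜ[ℂ] _ = _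
    rw [ht, R.arrowAction_eq_neg hα hu hr hρ, TensorProduct.neg_tmul]
    rfl

theorem finite_arrowModule [Finite G] : Module.Finite ℂ R.ArrowModule := by
  have : Finite (ConjClasses G) := inferInstanceAs (Finite (Quotient _))
  infer_instance

/-- The Nichols algebra of a ramification concentrated in a central class `{α}`, with `α` acting
by `-1`, is a central quantum linear space. -/
theorem isCentralQuantumLinearSpace_of_neg_one [Finite G] {C : ConjClasses G} {α : G}
    (hα : α ∈ Subgroup.center G)
    (hC : C.carrier = {α}) (hr : ∀ C', C' ≠ C → R.r C' = 0)
    (hρ : ∀ i, R.ρ C i (R.uCentralizer C) = -1) : R.IsCentralQuantumLinearSpace := by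
  have hflip := R.arrowBraiding_eq_neg_flip hα hC hr hρ
  have := R.finite_arrowModule
  refine ⟨⟨.of_neg_flip _ hflip, fun C' i => ?_, fun C' hC' => ?_⟩, NicholsAlgebra.finite_of_neg_flip _ hflip⟩
  · have hC' : C' = C := by
      by_contra hne
      exact (R.isEmpty_I (hr C' hne)).elim i
    subst hC'
    have := R.nontrivial_X C' i
    have h2 : orderOf (-1 : R.X C' i →ₗ[ℂ] R.X C' i) = 2 := by
      refine orderOf_eq_prime (by simp) fun h => ?_
      obtain ⟨v, hv⟩ := exists_ne (0 : R.X C' i)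
      exact hv (eq_zero_of_eq_neg_self (LinearMap.congr_fun h v).symm)
    rw [hρ, h2]
    exact Nat.one_lt_two
  · have hC'' : C' = C := by
      by_contra hne
      exact hC' (hr C' hne)
    subst hC''
    rw [hC]
    exact Set.singleton_subset_iff.2 hα

end RSR

/-! ### The centre of a classical Weyl group -/

namespace ClassicalWeylGroup

variable {t : ClassicalType} {n : ℕ}

instance finite : Finite (ClassicalWeylGroup t n) :=
  Finite.of_injective (fun x => (x.left, x.right)) fun _ _ h =>
    SemidirectProduct.ext (congrArg Prod.fst h) (congrArg Prod.snd h)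

/-- If the permutation part τ moves i, then n > 2 provides k outside {i, τ(i)}. The transposition of
τ(i) and k fixes i but moves τ(i), so it does not commute with τ. -/
theorem right_eq_one_of_mem_center (hn : 2 < n) {z : ClassicalWeylGroup t n}
    (hz : z ∈ Subgroup.center (ClassicalWeylGroup t n)) : z.right = 1 := by
  refine Equiv.ext fun i => ?_
  by_contra hi
  have hi : z.right i ≠ i := hi
  obtain ⟨k, hk⟩ : ∃ k, k ∉ ({i, z.right i} : Finset (Fin n)) := by
    by_contra! h
    have h1 : Fintype.card (Fin n) ≤ _ := Finset.card_le_card (fun k _ => h k : Finset.univ ⊆ _)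
    have h2 := Finset.card_le_two (a := i) (b := z.right i)
    rw [Fintype.card_fin] at h1
    omega
  simp only [Finset.mem_insert, Finset.mem_singleton, not_or] at hk
  have h := congrArg (fun x : ClassicalWeylGroup t n => x.right i)
    (Subgroup.mem_center_iff.1 hz (SemidirectProduct.inr (Equiv.swap (z.right i) k)))
  simp only [SemidirectProduct.mul_right, SemidirectProduct.right_inr, Equiv.Perm.mul_apply,
    Equiv.swap_apply_left, Equiv.swap_apply_of_ne_of_ne hi.symm (Ne.symm hk.1)] at h
  exact hk.2 h

/-- Commuting with the transposition of i and j equates these two coordinates. -/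
theorem left_apply_eq_of_mem_center {z : ClassicalWeylGroup t n}
    (hz : z ∈ Subgroup.center (ClassicalWeylGroup t n)) (i j : Fin n) :
    (z.left : Fin n → ℤˣ) i = (z.left : Fin n → ℤˣ) j := by
  have h : 1 * (z.left : Fin n → ℤˣ) ((Equiv.swap i j)⁻¹ j) = (z.left : Fin n → ℤˣ) j * 1 :=
    congrArg (fun x : ClassicalWeylGroup t n => (x.left : Fin n → ℤˣ) j)
      (Subgroup.mem_center_iff.1 hz (SemidirectProduct.inr (Equiv.swap i j)))
  rwa [Equiv.swap_inv, Equiv.swap_apply_right, one_mul, mul_one] at h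

/-- A central element other than `1` is the tuple `(g₂, …, g₂)`. -/
theorem left_apply_eq_neg_one (hn : 2 < n) {z : ClassicalWeylGroup t n}
    (hz : z ∈ Subgroup.center (ClassicalWeylGroup t n)) (h1 : z ≠ 1) (j : Fin n) :
    (z.left : Fin n → ℤˣ) j = -1 := by
  refine (Int.units_eq_one_or _).resolve_left fun h => h1 ?_
  refine SemidirectProduct.ext (Subtype.ext (funext fun i => ?_)) (right_eq_one_of_mem_center hn hz)
  exact (left_apply_eq_of_mem_center hz i j).trans h

theorem ext_of_eq_neg_one {x y : ClassicalWeylGroup t n}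
    (hx : ∀ j, (x.left : Fin n → ℤˣ) j = -1) (hx' : x.right = 1)
    (hy : ∀ j, (y.left : Fin n → ℤˣ) j = -1) (hy' : y.right = 1) : x = y :=
  SemidirectProduct.ext (Subtype.ext (funext fun i => (hx i).trans (hy i).symm)) (hx'.trans hy'.symm)

theorem mul_self_of_eq_neg_one {x : ClassicalWeylGroup t n}
    (hx : ∀ j, (x.left : Fin n → ℤˣ) j = -1) (hx' : x.right = 1) : x * x = 1 := by
  refine SemidirectProduct.ext (Subtype.ext (funext fun i => ?_)) ?_
  · simp [hx', hx]
  · simp [hx']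

end ClassicalWeylGroup

/-! ### Sign characters of A -/

section Characters

variable {t : ClassicalType} {n : ℕ}

theorem signCharacter_of_eq_neg_one (δ : Fin n → ℕ) {a : signSubgroup n t}
    (ha : ∀ j, (a : Fin n → ℤˣ) j = -1) : signCharacter t δ a = (-1) ^ ∑ j, δ j := by
  change ∏ j, ((((a : Fin n → ℤˣ) j : ℤˣ) : ℤ) : ℂ) ^ δ j = _
  simp [ha, Finset.prod_pow_eq_pow_sum]

/-- The sum over exponents in {0, 1} factors as ∏ (1 + a_j), which vanishes once some a_j is -1. -/
theorem sum_signCharacter (a : signSubgroup n t) [Decidable (a = 1)] :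
    ∑ δ : Fin n → Fin 2, signCharacter t (fun j => δ j) a = if a = 1 then 2 ^ n else 0 := by
  have h : ∑ δ : Fin n → Fin 2, signCharacter t (fun j => δ j) a =
      ∏ j, (1 + ((((a : Fin n → ℤˣ) j : ℤˣ) : ℤ) : ℂ)) := by
    have := Finset.prod_univ_sum (fun _ : Fin n => (Finset.univ : Finset (Fin 2)))
      (fun j d => ((((a : Fin n → ℤˣ) j : ℤˣ) : ℤ) : ℂ) ^ (d : ℕ))
    rw [Fintype.piFinset_univ] at this
    simp only [Fin.sum_univ_two, Fin.val_zero, Fin.val_one, pow_zero, pow_one] at this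
    exact this.symm
  rw [h]
  split_ifs with ha
  · subst ha
    norm_num
  · obtain ⟨j, hj⟩ : ∃ j, (a : Fin n → ℤˣ) j ≠ 1 := by
      by_contra! hall
      exact ha (Subtype.ext (funext hall))
    refine Finset.prod_eq_zero (Finset.mem_univ j) ?_
    rw [(Int.units_eq_one_or _).resolve_left hj]
    simp

/-- Some character `χ₂^{δ_1} ⊗ ⋯ ⊗ χ₂^{δ_n}` of `A` occurs in every nonzero representation. -/
theorem exists_characterSpace_signCharacter_ne_bot {G V : Type*} [Group G] [AddCommGroup V]
    [Module ℂ V] [Nontrivial V] (ρ : Representation ℂ G V) (j : signSubgroup n t →* G) :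
    ∃ δ : Fin n → ℕ, characterSpace ρ j (signCharacter t δ) ≠ ⊥ := by
  classical
  have := Fintype.ofFinite (signSubgroup n t)
  by_contra! h
  obtain ⟨v, hv⟩ := exists_ne (0 : V)
  -- If all these spaces vanished, so would the sum of the projections. Exchanging the sums shows
  -- that this sum is 2^n / |A| times v. Different δ may restrict to the same character of A; this
  -- affects only the multiplicity.
  have h1 : ∑ δ : Fin n → Fin 2,
      characterProjection ρ j (signCharacter t (fun k => δ k)) v = 0 :=
    Finset.sum_eq_zero fun δ _ => by
      have h2 := characterProjection_mem ρ j (signCharacter t (fun k => δ k)) v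
      rwa [h, Submodule.mem_bot] at h2
  simp only [characterProjection_apply] at h1
  rw [← Finset.smul_sum, Finset.sum_comm] at h1
  simp only [← Finset.sum_smul, sum_signCharacter, inv_eq_one, ite_smul, zero_smul,
    Finset.sum_ite_eq', Finset.mem_univ, if_true, map_one, Module.End.one_apply] at h1
  rw [smul_smul] at h1
  refine hv ((smul_eq_zero.1 h1).resolve_left ?_)
  refine mul_ne_zero (inv_ne_zero (Nat.cast_ne_zero.2 Fintype.card_ne_zero)) ?_
  exact pow_ne_zero _ two_ne_zero

end Characters

/-! ### The representations θ for a central element -/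

section CentralElement

variable {t : ClassicalType} {n : ℕ} {σ : ClassicalWeylGroup t n}

/-- The inclusion of `A` into the centralizer of a central element. -/
def centralizerInl (hσ : σ ∈ Subgroup.center (ClassicalWeylGroup t n)) :
    signSubgroup n t →* Subgroup.centralizer {σ} :=
  SemidirectProduct.inl.codRestrict _ fun _ =>
    Subgroup.mem_centralizer_singleton_iff.2 (Subgroup.mem_center_iff.1 hσ _)

/-- The inclusion of `(𝕊_n^σ)_χ` into the centralizer of `σ`. -/
def centralizerInr (σ : ClassicalWeylGroup t n) (χ : signSubgroup n t →* ℂ) :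
    permStabilizer σ χ →* Subgroup.centralizer {σ} :=
  (SemidirectProduct.inr.comp (Subgroup.subtype _)).codRestrict _ fun τ =>
    Subgroup.mem_centralizer_singleton_iff.2 τ.2.1

theorem centralizerInl_mul_centralizerInr (hσ : σ ∈ Subgroup.center (ClassicalWeylGroup t n))
    {χ : signSubgroup n t →* ℂ} {x : Subgroup.centralizer {σ}}
    (hx : (x : ClassicalWeylGroup t n).right ∈ permStabilizer σ χ) :
    centralizerInl hσ (x : ClassicalWeylGroup t n).left * centralizerInr σ χ ⟨_, hx⟩ = x :=
  Subtype.ext (SemidirectProduct.inl_left_mul_inr_right (x : ClassicalWeylGroup t n))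

theorem centralizerInl_permAction (hσ : σ ∈ Subgroup.center (ClassicalWeylGroup t n))
    (g : Subgroup.centralizer {σ}) (a : signSubgroup n t) :
    centralizerInl hσ (permAction n t (g : ClassicalWeylGroup t n).right a) =
      g * centralizerInl hσ a * g⁻¹ := by
  rw [eq_mul_inv_iff_mul_eq]
  refine Subtype.ext (SemidirectProduct.ext ?_ ?_)
  · simp [centralizerInl, mul_comm]
  · simp [centralizerInl]

/-- Since σ is central, the commutation condition in `permStabilizer` is automatic. This and
`centralizerInl_permAction` are the inputs of the Clifford argument. -/
theorem mem_centralizerStabilizer_iff (hσ : σ ∈ Subgroup.center (ClassicalWeylGroup t n))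
    {χ : signSubgroup n t →* ℂ} (g : Subgroup.centralizer {σ}) :
    g ∈ centralizerStabilizer σ χ ↔
      ∀ a, χ (permAction n t (g : ClassicalWeylGroup t n).right a) = χ a := by
  change (g : ClassicalWeylGroup t n).right ∈ permStabilizer σ χ ↔ _
  refine ⟨fun h a => ?_, fun h => ⟨Subgroup.mem_center_iff.1 hσ _, fun a => ?_⟩⟩
  · have := (inv_mem h).2 a
    rwa [inv_inv] at this
  · rw [← h, ← MulAut.mul_apply, ← map_mul, mul_inv_cancel, map_one, MulAut.one_apply]

variable {V : Type*} [AddCommGroup V] [Module ℂ V]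

/-- The representation of `(𝕊_n^σ)_χ` on the `χ`-space of a representation of `G^σ`. -/
def stabilizerRepresentation (hσ : σ ∈ Subgroup.center (ClassicalWeylGroup t n))
    (χ : signSubgroup n t →* ℂ) (ρ : Representation ℂ (Subgroup.centralizer {σ}) V) :
    Representation ℂ (permStabilizer σ χ) (characterSpace ρ (centralizerInl hσ) χ) where
  toFun τ := (ρ (centralizerInr σ χ τ)).restrict fun _ hw =>
    apply_mem_characterSpace
      (c := fun g : Subgroup.centralizer {σ} => (permAction n t (g : ClassicalWeylGroup t n).right).toMonoidHom)
      (centralizerInl_permAction hσ) (mem_centralizerStabilizer_iff hσ) τ.2 hw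
  map_one' := by ext; simp
  map_mul' x y := by ext; simp

/-- Factor h as aτ: on the χ-space the part a acts by the scalar χ(a), so restricting ρ there gives
exactly χ ⊗ μ. -/
theorem coe_tensorCharacter_stabilizerRepresentation
    (hσ : σ ∈ Subgroup.center (ClassicalWeylGroup t n)) (χ : signSubgroup n t →* ℂ)
    (ρ : Representation ℂ (Subgroup.centralizer {σ}) V) (h : centralizerStabilizer σ χ)
    (w : characterSpace ρ (centralizerInl hσ) χ) :
    (tensorCharacter σ χ (stabilizerRepresentation hσ χ ρ) h w : V) = ρ h w := by
  have h1 := (stabilizerRepresentation hσ χ ρ ⟨_, h.2⟩ w).2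
    (h : ClassicalWeylGroup t n).left
  conv_rhs => rw [← centralizerInl_mul_centralizerInr hσ h.2, map_mul,
    Module.End.mul_apply]
  exact h1.symm

theorem stabilizerRepresentation_isIrreducible
    (hσ : σ ∈ Subgroup.center (ClassicalWeylGroup t n)) (χ : signSubgroup n t →* ℂ)
    (ρ : Representation ℂ (Subgroup.centralizer {σ}) V) [ρ.IsIrreducible]
    (h0 : characterSpace ρ (centralizerInl hσ) χ ≠ ⊥) :
    (stabilizerRepresentation hσ χ ρ).IsIrreducible where
  exists_pair_ne := by
    refine ⟨⊥, ⊤, fun h => h0 (eq_bot_iff.2 fun w hw => ?_)⟩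
    have h1 : (⟨w, hw⟩ : characterSpace ρ (centralizerInl hσ) χ) ∈
        (⊥ : Subrepresentation (stabilizerRepresentation hσ χ ρ)) := by
      rw [h]
      exact Submodule.mem_top
    exact congrArg Subtype.val ((Submodule.mem_bot ℂ).1 h1)
  eq_bot_or_eq_top U := by
    -- Because A acts on the χ-space by scalars, a subspace stable under the permutations is stable
    -- under the full stabilizer, and the Clifford dichotomy applies to its image in V.
    have key := eq_bot_or_eq_of_le_characterSpace
      (c := fun g : Subgroup.centralizer {σ} => (permAction n t (g : ClassicalWeylGroup t n).right).toMonoidHom)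
      (centralizerInl_permAction hσ) (mem_centralizerStabilizer_iff hσ)
      (Submodule.map_subtype_le (characterSpace ρ (centralizerInl hσ) χ) U.toSubmodule)
      (fun g hg => by
        rintro _ ⟨u, hu, rfl⟩
        rw [Submodule.subtype_apply,
          ← coe_tensorCharacter_stabilizerRepresentation hσ χ ρ ⟨g, hg⟩ u]
        exact ⟨_, U.toSubmodule.smul_mem _ (U.apply_mem_toSubmodule _ hu), rfl⟩)
    refine key.imp (fun h => ?_) fun h => ?_
    · refine Subrepresentation.toSubmodule_injective
        (Submodule.map_injective_of_injective (Submodule.subtype_injective _) ?_)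
      exact h.trans (Submodule.map_bot _).symm
    · refine Subrepresentation.toSubmodule_injective (eq_top_iff.2 fun w _ => ?_)
      have hw : (w : V) ∈ U.toSubmodule.map
        (characterSpace ρ (centralizerInl hσ) χ).subtype := h.symm ▸ w.2
      obtain ⟨u, hu, huw⟩ := hw
      exact Subtype.ext huw ▸ hu

/-- Irreducible representations of the centralizer of a central element are of the form
`θ_{χ, μ}`, for every character `χ` of `A` that occurs in them. -/
theorem nonempty_equiv_theta
    (hσ : σ ∈ Subgroup.center (ClassicalWeylGroup t n)) (χ : signSubgroup n t →* ℂ)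
    (ρ : Representation ℂ (Subgroup.centralizer {σ}) V) [ρ.IsIrreducible]
    (h0 : characterSpace ρ (centralizerInl hσ) χ ≠ ⊥) :
    Nonempty (ρ.Equiv (theta σ χ (stabilizerRepresentation hσ χ ρ))) :=
  nonempty_equiv_ind_characterSpace
    (c := fun g : Subgroup.centralizer {σ} => (permAction n t (g : ClassicalWeylGroup t n).right).toMonoidHom)
    (centralizerInl_permAction hσ) (mem_centralizerStabilizer_iff hσ) h0 _
    (coe_tensorCharacter_stabilizerRepresentation hσ χ ρ)

/-- σ is central in its own centralizer, so it acts on the induced module by the scalar χ(σ) =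
(-1)^(∑ δ_j). -/
theorem theta_apply_eq_neg_one {W : Type*} [AddCommGroup W] [Module ℂ W]
    (hσ : ∀ j, (σ.left : Fin n → ℤˣ) j = -1) (hσ' : σ.right = 1) {δ : Fin n → ℕ}
    (hδ : Odd (∑ j, δ j)) (μ : Representation ℂ (permStabilizer σ (signCharacter t δ)) W)
    (z : Subgroup.centralizer {σ}) (hz : (z : ClassicalWeylGroup t n) = σ) :
    theta σ (signCharacter t δ) μ z = -1 := by
  have hmem : (z : ClassicalWeylGroup t n).right ∈ permStabilizer σ (signCharacter t δ) := by
    rw [hz, hσ']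
    exact one_mem _
  have hcen : z ∈ Subgroup.center (Subgroup.centralizer {σ}) := by
    refine Subgroup.mem_center_iff.2 fun g => Subtype.ext ?_
    change (g : ClassicalWeylGroup t n) * (z : ClassicalWeylGroup t n) = z * g
    have hg : (g : ClassicalWeylGroup t n) ∈ Subgroup.centralizer {(z : ClassicalWeylGroup t n)} := by
      rw [hz]
      exact g.2
    exact Subgroup.mem_centralizer_singleton_iff.1 hg
  have h1 : (⟨(z : ClassicalWeylGroup t n).right, hmem⟩ :
      permStabilizer σ (signCharacter t δ)) = 1 := 
    Subtype.ext ((congrArg SemidirectProduct.right hz).trans hσ')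
  have h := Representation.ind_apply_of_central
    (tensorCharacter σ (signCharacter t δ) μ) ⟨z, hmem⟩ hcen (s := -1) fun w => by
      change signCharacter t δ (z : ClassicalWeylGroup t n).left •
        μ ⟨(z : ClassicalWeylGroup t n).right, hmem⟩ w = _
      rw [h1, map_one, hz, signCharacter_of_eq_neg_one δ hσ, hδ.neg_one_pow,
        Module.End.one_apply]
  refine Eq.trans h ?_
  rw [neg_one_smul]
  rfl

end CentralElement

/-! ### Central conjugacy classes and the equivalence -/

theorem ConjClasses.carrier_eq_singleton {G : Type*} [Group G] {C : ConjClasses G} {z : G}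
    (hz : z ∈ Subgroup.center G) (hzC : z ∈ C.carrier) : C.carrier = {z} := by
  refine Set.eq_singleton_iff_unique_mem.2 ⟨hzC, fun x hx => ?_⟩
  obtain ⟨g, hg⟩ := isConj_iff.1 (ConjClasses.mk_eq_mk_iff_isConj.1
    ((ConjClasses.mem_carrier_iff_mk_eq.1 hzC).trans (ConjClasses.mem_carrier_iff_mk_eq.1 hx).symm))
  rw [← hg, Subgroup.mem_center_iff.1 hz, mul_inv_cancel_right]

theorem ConjClasses.mem_center_of_carrier_eq_singleton {G : Type*} [Group G] {C : ConjClasses G}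
    {z : G} (hC : C.carrier = {z}) : z ∈ Subgroup.center G := by
  refine Subgroup.mem_center_iff.2 fun g => ?_
  have hz : z ∈ C.carrier := hC ▸ Set.mem_singleton z
  have h : g * z * g⁻¹ ∈ C.carrier := ConjClasses.mem_carrier_iff_mk_eq.2
    ((ConjClasses.mk_eq_mk_iff_isConj.2 (isConj_iff.2 ⟨g, rfl⟩).symm).trans
      (ConjClasses.mem_carrier_iff_mk_eq.1 hz))
  rw [hC] at h
  exact mul_inv_eq_iff_eq_mul.1 h

namespace RSR

variable {G : Type*} [Group G] {R : RSR.{w} G}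

/-- A class with r_C ≠ 0 has a constituent, on which the identity would act with order 1. -/
theorem IsNonEssentiallyInfinite.u_ne_one (h : R.IsNonEssentiallyInfinite) {C : ConjClasses G}
    (hC : R.r C ≠ 0) : R.u C ≠ 1 := fun h1 => by
  obtain ⟨i⟩ := R.nonempty_I hC
  have h2 := h C i
  have h3 : R.uCentralizer C = 1 := Subtype.ext h1
  rw [h3, map_one, orderOf_one] at h2
  exact lt_irrefl _ h2

end RSR

theorem mainTheorem8 (t : ClassicalType) (n : ℕ) (hn : 2 < n)
    (R : RSR.{w} (ClassicalWeylGroup t n)) (hR : R.r ≠ 0) :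
    R.IsCentralQuantumLinearSpace ↔
      ∃ (α : ClassicalWeylGroup t n) (C : ConjClasses (ClassicalWeylGroup t n)),
        (∀ j, (α.left : Fin n → ℤˣ) j = -1) ∧ α.right = 1 ∧
        C.carrier = {α} ∧
        (∀ C', C' ≠ C → R.r C' = 0) ∧
        ∀ i : R.I C, ∃ δ : Fin n → ℕ, Odd (∑ j, δ j) ∧
          ∃ (W : Type w) (_ : AddCommGroup W) (_ : Module ℂ W)
            (μ : Representation ℂ (permStabilizer (R.u C) (signCharacter t δ)) W),
            μ.IsIrreducible ∧
            Nonempty ((R.ρ C i).Equiv (theta (R.u C) (signCharacter t δ) μ)) := by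
  constructor
  · intro h
    have hcen : ∀ C, R.r C ≠ 0 → R.u C ∈ Subgroup.center (ClassicalWeylGroup t n) :=
      fun C hC => h.type.central C hC (R.u_mem C)
    have hleft : ∀ C, R.r C ≠ 0 → ∀ j, ((R.u C).left : Fin n → ℤˣ) j = -1 := fun C hC =>
      ClassicalWeylGroup.left_apply_eq_neg_one hn (hcen C hC)
        (h.type.nonEssentiallyInfinite.u_ne_one hC)
    have hright : ∀ C, R.r C ≠ 0 → (R.u C).right = 1 := fun C hC =>
      ClassicalWeylGroup.right_eq_one_of_mem_center hn (hcen C hC)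
    obtain ⟨C, hC⟩ := Function.ne_iff.1 hR
    have hC : R.r C ≠ 0 := hC
    have hσ := hcen C hC
    refine ⟨R.u C, C, hleft C hC, hright C hC, ConjClasses.carrier_eq_singleton hσ (R.u_mem C),
      fun C' hne => ?_, fun i => ?_⟩
    -- Any other class in the ramification would also have α as its representative.
    · by_contra hC'
      have hu : R.u C' = R.u C := ClassicalWeylGroup.ext_of_eq_neg_one (hleft C' hC')
        (hright C' hC') (hleft C hC) (hright C hC)
      exact hne ((ConjClasses.mem_carrier_iff_mk_eq.1 (R.u_mem C')).symm.trans
        (hu ▸ ConjClasses.mem_carrier_iff_mk_eq.1 (R.u_mem C)))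
    · have := R.irreducible C i
      have := R.nontrivial_X C i
      have hz : R.uCentralizer C ∈ Subgroup.center (Subgroup.centralizer {R.u C}) :=
        Subgroup.mem_center_iff.2 fun g => Subtype.ext (Subgroup.mem_center_iff.1 hσ g)
      have hz2 : R.uCentralizer C * R.uCentralizer C = 1 := Subtype.ext
        (ClassicalWeylGroup.mul_self_of_eq_neg_one (hleft C hC) (hright C hC))
      have hneg : R.ρ C i (R.uCentralizer C) = -1 := by
        refine (Representation.IsIrreducible.eq_one_or_eq_neg_one hz hz2).resolve_left fun h1 => ?_
        have h2 := h.type.nonEssentiallyInfinite C i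
        rw [h1, orderOf_one] at h2
        exact lt_irrefl _ h2
      obtain ⟨δ, hδ⟩ := exists_characterSpace_signCharacter_ne_bot (R.ρ C i) (centralizerInl hσ)
      refine ⟨δ, ?_, _, _, _, stabilizerRepresentation hσ (signCharacter t δ) (R.ρ C i),
        stabilizerRepresentation_isIrreducible hσ _ _ hδ, nonempty_equiv_theta hσ _ _ hδ⟩
      -- On a nonzero vector of the χ-space, α acts both by -1 and by (-1)^(∑ δ_j); an even sum
      -- would give w = -w.
      obtain ⟨w, hw, hw0⟩ := Submodule.exists_mem_ne_zero_of_ne_bot hδ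
      have h1 := hw (R.u C).left
      have h2 : centralizerInl hσ (R.u C).left = R.uCentralizer C :=
        Subtype.ext (SemidirectProduct.ext rfl (hright C hC).symm)
      rw [h2, hneg, signCharacter_of_eq_neg_one δ (hleft C hC)] at h1
      by_contra hodd
      rw [(Nat.not_odd_iff_even.1 hodd).neg_one_pow, one_smul] at h1
      exact hw0 (eq_zero_of_eq_neg_self h1.symm)
  · rintro ⟨α, C, hα, hα', hC, hr, hρ⟩
    have hu : R.u C = α := by
      have := R.u_mem C
      rwa [hC] at this
    refine R.isCentralQuantumLinearSpace_of_neg_one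
      (ConjClasses.mem_center_of_carrier_eq_singleton hC) hC hr fun i => ?_
    obtain ⟨δ, hδ, W, _, _, μ, -, ⟨e⟩⟩ := hρ i
    subst hu
    -- It suffices to compare after applying the equivalence with θ, where α acts by -1.
    refine LinearMap.ext fun v => e.toLinearEquiv.injective ?_
    have h1 : e.toLinearEquiv (R.ρ C i (R.uCentralizer C) v) =
        theta (R.u C) (signCharacter t δ) μ (R.uCentralizer C) (e.toLinearEquiv v) :=
      LinearMap.congr_fun (e.isIntertwining' (R.uCentralizer C)) v
    rw [h1, theta_apply_eq_neg_one hα hα' hδ μ _ rfl]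
    exact (map_neg e.toLinearEquiv v).symm

end
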